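/- Let $\mathbb G_2=\{(a+b,ab): |a|<1,|b|<1\}$, $\Gamma=\overline{\mathbb G_2}$ and $b\Gamma=\{(a+b,ab):|a|=|b|=1\}$. A polynomial $p\in\mathbb C[z_1,z_2]$ with zero set $Z(p)$ is $\Gamma$-distinguished if $Z(p)\cap\mathbb G_2\neq\emptyset$ and $Z(p)\cap\partial\Gamma=Z(p)\cap b\Gamma$. A commuting pair $(S,P)$ of operators on a Hilbert space is a $\Gamma$-contraction if its Taylor joint spectrum lies in $\Gamma$ and $\|f(S,P)\|\le\sup_\Gamma|f|$ for every rational function $f=p/q$ whose denominator $q$ has no zeros in $\Gamma$; it is $\Gamma$-distinguished if $p(S,P)=0$ for some $\Gamma$-distinguished polynomial $p$. With $D_P=(I-P^*P)^{1/2}$ and $\mathcal D_P=\overline{\operatorname{Ran}}\,D_P$, the fundamental operator of $(S,P)$ is the unique $A\in\mathcal B(\mathcal D_P)$ with $S-S^*P=D_PAD_P$. Write $\omega(A)=\sup\{|\langle Ax,x\rangle|:\|x\|=1\}$ for the numerical radius (equal to $0$ if $\mathcal D_P=\{0\}$). Proposition. Let $(S,P)$ be a $\Gamma$-contraction on a finite-dimensional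 complex Hilbert space, and let $A$ be its fundamental operator, with $\omega(A)<1$. Then: (1) $(S,P)$ is $\Gamma$-distinguished. (2) If $\mathcal D_P\ne\{0\}$, then the polynomials $\det(A^*+z_2A-z_1I)$ and $\det(A+z_2A^*-z_1I)$ are $\Gamma$-distinguished. (3) If $P$ is pure, i.e. $P^{*n}\to0$ strongly, then the polynomial $\det(A+z_2A^*-z_1I)$ annihilates $(S,P)$. -/

import Mathlib

open scoped InnerProductSpace

noncomputable section

namespace SymBidisc

/-- The symmetrization map `π(a, b) = (a + b, a b)`. -/
def symMap (w : ℂ × ℂ) : ℂ × ℂ := (w.1 + w.2, w.1 * w.2)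

/-- The open symmetrized bidisc `𝔾₂ = π(𝔻²)`. -/
def openBidisc : Set (ℂ × ℂ) := symMap '' {w | ‖w.1‖ < 1 ∧ ‖w.2‖ < 1}

/-- The closed symmetrized bidisc `Γ`, the image under `π` of the closed bidisc. -/
def Gam : Set (ℂ × ℂ) := symMap '' {w | ‖w.1‖ ≤ 1 ∧ ‖w.2‖ ≤ 1}

/-- The distinguished boundary `bΓ = π(𝕋²)`. -/
def bGam : Set (ℂ × ℂ) := symMap '' {w | ‖w.1‖ = 1 ∧ ‖w.2‖ = 1}

/-- The value of `p ∈ ℂ[z₁, z₂]` at a point; the variable `X 0` is `z₁` and `X 1` is `z₂`. -/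
def evalPt (p : MvPolynomial (Fin 2) ℂ) (z : ℂ × ℂ) : ℂ := MvPolynomial.eval ![z.1, z.2] p

/-- The zero set `Z(p) ⊆ ℂ²`. -/
def zeroSet (p : MvPolynomial (Fin 2) ℂ) : Set (ℂ × ℂ) := {z | evalPt p z = 0}

/-- `p` is `Γ`-distinguished: `Z(p)` meets `𝔾₂`, and `Z(p) ∩ ∂Γ = Z(p) ∩ bΓ`. -/
def IsDistinguishedPoly (p : MvPolynomial (Fin 2) ℂ) : Prop :=
  (zeroSet p ∩ openBidisc).Nonempty ∧ zeroSet p ∩ frontier Gam = zeroSet p ∩ bGam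

section Operators

variable {H : Type*} [NormedAddCommGroup H] [InnerProductSpace ℂ H]

/-- `p(S, P)`, for a commuting pair `(S, P)`. -/
def polyApply (p : MvPolynomial (Fin 2) ℂ) (S P : H →L[ℂ] H) : H →L[ℂ] H :=
  ∑ m ∈ p.support, p.coeff m • (S ^ m 0 * P ^ m 1)

/-- The Taylor joint spectrum of a commuting pair `(S, P)`: the points `z` for which the Koszul
complex `0 → H → H ⊕ H → H → 0` of `(S - z₁, P - z₂)`, with the maps
`x ↦ ((S - z₁) x, (P - z₂) x)` and `(x, y) ↦ (S - z₁) y - (P - z₂) x`, is not exact. -/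
def taylorSpectrum (S P : H →L[ℂ] H) : Set (ℂ × ℂ) :=
  {z | ¬ ((∀ x : H, S x - z.1 • x = 0 → P x - z.2 • x = 0 → x = 0) ∧
          (∀ x y : H, (S y - z.1 • y) - (P x - z.2 • x) = 0 →
            ∃ w : H, S w - z.1 • w = x ∧ P w - z.2 • w = y) ∧
          (∀ u : H, ∃ x y : H, (S y - z.1 • y) - (P x - z.2 • x) = u))}

/-- `(S, P)` is a `Γ`-contraction: `S` and `P` commute and `Γ` is a spectral set for `(S, P)`, that
is, the Taylor joint spectrum lies in `Γ` and von Neumann's inequality holds on `Γ` for all rational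
functions `p / q` whose denominator has no zero in `Γ`. (For such `q` the operator `q(S, P)` is
invertible, by the inclusion of the spectrum.) -/
structure IsGammaContraction (S P : H →L[ℂ] H) : Prop where
  commute : Commute S P
  spectrum_subset : taylorSpectrum S P ⊆ Gam
  norm_le : ∀ p q : MvPolynomial (Fin 2) ℂ, (∀ z ∈ Gam, evalPt q z ≠ 0) →
    ‖polyApply p S P * Ring.inverse (polyApply q S P)‖ ≤
      ⨆ z : Gam, ‖evalPt p z / evalPt q z‖

/-- `(S, P)` is a `Γ`-distinguished `Γ`-contraction. -/
def IsDistinguishedContraction (S P : H →L[ℂ] H) : Prop :=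
  IsGammaContraction S P ∧
    ∃ p : MvPolynomial (Fin 2) ℂ, IsDistinguishedPoly p ∧ polyApply p S P = 0

/-- The numerical radius `ω(T) = sup {|⟪T x, x⟫| : ‖x‖ = 1}`; it is `0` on the zero space. -/
def numericalRadius (T : H →L[ℂ] H) : ℝ := sSup {r | ∃ x : H, ‖x‖ = 1 ∧ r = ‖⟪T x, x⟫_ℂ‖}

variable [CompleteSpace H]

/-- `P` is pure: `P*ⁿ → 0` strongly. -/
def IsPure (P : H →L[ℂ] H) : Prop :=
  ∀ x : H, Filter.Tendsto (fun n : ℕ => (ContinuousLinearMap.adjoint P ^ n) x)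
    Filter.atTop (nhds 0)

/-- The defect operator `D_P = (I - P* P)^{1/2}` of a contraction `P`. -/
def defectOp (P : H →L[ℂ] H) : H →L[ℂ] H :=
  CFC.sqrt (1 - ContinuousLinearMap.adjoint P * P)

/-- The defect space `𝒟_P`, the closure of the range of `D_P`. -/
abbrev defectSpace (P : H →L[ℂ] H) : Submodule ℂ H :=
  (LinearMap.range (defectOp P).toLinearMap).topologicalClosure

/-- `D_P x` as an element of `𝒟_P`. -/
def toDefect (P : H →L[ℂ] H) (x : H) : defectSpace P :=
  ⟨defectOp P x, Submodule.le_topologicalClosure _ ⟨x, rfl⟩⟩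

/-- `A ∈ B(𝒟_P)` is the fundamental operator of `(S, P)`: `S - S* P = D_P A D_P`.
(At most one operator on `𝒟_P` satisfies this.) -/
def IsFundamentalOperator (S P : H →L[ℂ] H) (A : defectSpace P →L[ℂ] defectSpace P) : Prop :=
  ∀ x : H, S x - ContinuousLinearMap.adjoint S (P x) = defectOp P (A (toDefect P x) : H)

end Operators

/-- For an operator `B` on a finite-dimensional Hilbert space `E`, the polynomial
`det (B* + z₂ B - z₁ I)`, computed in a fixed orthonormal basis. -/
def detPoly {E : Type*} [NormedAddCommGroup E] [InnerProductSpace ℂ E] [CompleteSpace E]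
    [FiniteDimensional ℂ E] (B : E →L[ℂ] E) : MvPolynomial (Fin 2) ℂ :=
  let b := (stdOrthonormalBasis ℂ E).toBasis
  Matrix.det
    ((LinearMap.toMatrix b b (ContinuousLinearMap.adjoint B).toLinearMap).map MvPolynomial.C +
      (MvPolynomial.X 1 : MvPolynomial (Fin 2) ℂ) •
        (LinearMap.toMatrix b b B.toLinearMap).map MvPolynomial.C -
      (MvPolynomial.X 0 : MvPolynomial (Fin 2) ℂ) • 1)

end SymBidisc

end

open scoped InnerProductSpace

noncomputable section

namespace SymBidisc

/-! ### The geometry of the symmetrized bidisc -/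

/-! Everything rests on the curves `c̄ + c z₂ = z₁` with `|c| < 1`: at `(a + b, a b)` with `|a| = 1`
this equation forces `|b| = 1` (`norm_eq_one_of_conj_add_mul`), so they are `Γ`-distinguished.

(1) Pairing `S - S*P = D_P A D_P` with a joint eigenvector gives `|s - s̄ p| ≤ ω(A)(1 - |p|²)` when
`|p| < 1`, which puts `(s, p)` on such a curve; a joint eigenvalue with `|p| = 1` lies in `bΓ` and
is on such a curve or on the royal variety. A finite product of these polynomials vanishes at all
joint eigenvalues, hence is nilpotent on `(S, P)`, and a power of it annihilates the pair.

(2) A kernel vector `x` of the pencil, paired with itself, puts the zero on the curve with `c = ⟪x,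
B x⟫`.

(3) By `D_P S = A D_P + A* D_P P` and Cramer's rule, `D_P Q = 0` for `Q = det(A + z₂A* - z₁)(S, P)`.
Then `P` is isometric on the range of `Q`, and purity forces `Q = 0`. -/

lemma symMap_swap (a b : ℂ) : symMap (a, b) = symMap (b, a) := by
  simp [symMap, add_comm, mul_comm]

/-- Since `1 - s w + p w² = (1 - a w)(1 - b w)`, a root in the closed disc exists exactly when `|a|
≥ 1` or `|b| ≥ 1`. Projecting along the compact disc is a closed map, whence `isOpen_openBidisc`. -/
lemma compl_openBidisc :
    openBidiscᶜ = Prod.snd '' {x : Metric.closedBall (0 : ℂ) 1 × (ℂ × ℂ) |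
      1 - x.2.1 * (x.1 : ℂ) + x.2.2 * (x.1 : ℂ) ^ 2 = 0} := by
  ext ⟨s, p⟩
  constructor
  · intro h
    obtain ⟨r, hr⟩ := IsAlgClosed.exists_pow_nat_eq (s ^ 2 - 4 * p) (n := 2) (by norm_num)
    have key : ∀ a b : ℂ, a + b = s → a * b = p → 1 ≤ ‖a‖ →
        ∃ x : Metric.closedBall (0 : ℂ) 1 × (ℂ × ℂ),
          1 - x.2.1 * (x.1 : ℂ) + x.2.2 * (x.1 : ℂ) ^ 2 = 0 ∧ x.2 = (s, p) := by
      intro a b h1 h2 ha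
      have ha0 : a ≠ 0 := by rintro rfl; simp at ha; linarith
      refine ⟨(⟨a⁻¹, ?_⟩, (s, p)), ?_, rfl⟩
      · simpa using inv_le_one_of_one_le₀ ha
      · simp only [← h1, ← h2]
        field_simp
        ring
    have h1 : (s + r) / 2 + (s - r) / 2 = s := by ring
    have h2 : (s + r) / 2 * ((s - r) / 2) = p := by linear_combination (-1 / 4) * hr
    by_cases ha : 1 ≤ ‖(s + r) / 2‖
    · exact key _ _ h1 h2 ha
    by_cases hb : 1 ≤ ‖(s - r) / 2‖
    · exact key _ _ (by rw [add_comm, h1]) (by rw [mul_comm, h2]) hb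
    · exact absurd ⟨((s + r) / 2, (s - r) / 2), ⟨not_le.1 ha, not_le.1 hb⟩,
        Prod.ext h1 h2⟩ h
  · rintro ⟨⟨⟨w, hw⟩, _⟩, h, rfl⟩ ⟨⟨a, b⟩, ⟨ha, hb⟩, hab⟩
    simp only [symMap, Prod.mk.injEq] at hab
    obtain ⟨rfl, rfl⟩ := hab
    have hw' : ‖w‖ ≤ 1 := by simpa using hw
    have h' : (1 - a * w) * (1 - b * w) = 0 := by
      have : 1 - (a + b) * w + a * b * w ^ 2 = 0 := h
      linear_combination this
    have aux : ∀ c : ℂ, ‖c‖ < 1 → 1 - c * w ≠ 0 := by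
      intro c hc h0
      have h1 : ‖c * w‖ = 1 := by rw [← sub_eq_zero.1 h0, norm_one]
      rw [norm_mul] at h1
      nlinarith [norm_nonneg c, norm_nonneg w]
    rcases mul_eq_zero.1 h' with h0 | h0
    · exact aux a ha h0
    · exact aux b hb h0

lemma isOpen_openBidisc : IsOpen openBidisc := by
  rw [← isClosed_compl_iff, compl_openBidisc]
  refine isClosedMap_snd_of_compactSpace _ ?_
  exact isClosed_eq (by fun_prop) continuous_const

lemma isClosed_Gam : IsClosed Gam := by
  refine IsCompact.isClosed ?_
  have h : IsCompact {w : ℂ × ℂ | ‖w.1‖ ≤ 1 ∧ ‖w.2‖ ≤ 1} := by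
    convert (isCompact_closedBall (0 : ℂ) 1).prod (isCompact_closedBall (0 : ℂ) 1) using 1
    ext w
    simp
  exact h.image (by unfold symMap; fun_prop)

lemma openBidisc_subset_Gam : openBidisc ⊆ Gam := by
  rintro _ ⟨w, hw, rfl⟩
  exact ⟨w, ⟨hw.1.le, hw.2.le⟩, rfl⟩

lemma bGam_subset_Gam : bGam ⊆ Gam := by
  rintro _ ⟨w, hw, rfl⟩
  exact ⟨w, ⟨hw.1.le, hw.2.le⟩, rfl⟩

lemma norm_snd_le_of_mem_Gam {z : ℂ × ℂ} (hz : z ∈ Gam) : ‖z.2‖ ≤ 1 := by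
  obtain ⟨w, hw, rfl⟩ := hz
  simpa [symMap] using mul_le_one₀ hw.1 (norm_nonneg _) hw.2

lemma norm_snd_eq_of_mem_bGam {z : ℂ × ℂ} (hz : z ∈ bGam) : ‖z.2‖ = 1 := by
  obtain ⟨w, hw, rfl⟩ := hz
  simp [symMap, hw.1, hw.2]

/-- Scaling the second coordinate by `t > 1` leaves `Γ`, where `|z₂| ≤ 1`. -/
lemma bGam_subset_frontier : bGam ⊆ frontier Gam := by
  intro z hz
  rw [isClosed_Gam.frontier_eq]
  refine ⟨bGam_subset_Gam hz, fun hi => ?_⟩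
  have hc : ContinuousAt (fun t : ℝ => (z.1, (t : ℂ) * z.2)) 1 := by fun_prop
  have h1 : ∀ᶠ t : ℝ in nhds 1, (z.1, (t : ℂ) * z.2) ∈ Gam := by
    refine hc ?_
    simpa using mem_interior_iff_mem_nhds.1 hi
  obtain ⟨ε, hε, h2⟩ := Metric.eventually_nhds_iff.1 h1
  have h3 := norm_snd_le_of_mem_Gam (h2 (y := 1 + ε / 2) (by
    rw [Real.dist_eq, add_sub_cancel_left, abs_of_pos (by linarith)]; linarith))
  rw [norm_mul, norm_snd_eq_of_mem_bGam hz, Complex.norm_real, Real.norm_eq_abs,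
    abs_of_pos (by linarith)] at h3
  linarith

/-- A polynomial is `Γ`-distinguished as soon as it has a zero in `𝔾₂` and its zeros
`(a + b, a b)` with `|a| = 1`, `|b| ≤ 1` satisfy `|b| = 1`. -/
lemma isDistinguishedPoly_of_forall {p : MvPolynomial (Fin 2) ℂ}
    (h0 : (zeroSet p ∩ openBidisc).Nonempty)
    (h : ∀ a b : ℂ, ‖a‖ = 1 → ‖b‖ ≤ 1 → evalPt p (a + b, a * b) = 0 → ‖b‖ = 1) :
    IsDistinguishedPoly p := by
  refine ⟨h0, Set.Subset.antisymm ?_ (Set.inter_subset_inter_right _ bGam_subset_frontier)⟩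
  rintro z ⟨hz, hf⟩
  refine ⟨hz, ?_⟩
  rw [isClosed_Gam.frontier_eq] at hf
  obtain ⟨⟨⟨a, b⟩, ⟨ha, hb⟩, rfl⟩, hi⟩ := hf
  have hn : ¬ (‖a‖ < 1 ∧ ‖b‖ < 1) := fun hab =>
    hi (interior_maximal openBidisc_subset_Gam isOpen_openBidisc ⟨(a, b), hab, rfl⟩)
  by_cases ha' : ‖a‖ < 1
  · have hb' : ‖b‖ = 1 := le_antisymm hb (not_lt.1 fun hb' => hn ⟨ha', hb'⟩)
    rw [symMap_swap] at hz
    exact ⟨(a, b), ⟨h b a hb' ha hz, hb'⟩, rfl⟩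
  · have ha' : ‖a‖ = 1 := le_antisymm ha (not_lt.1 ha')
    exact ⟨(a, b), ⟨ha', h a b ha' hb hz⟩, rfl⟩

/-! ### Distinguished polynomials -/

lemma evalPt_mul (p q : MvPolynomial (Fin 2) ℂ) (z : ℂ × ℂ) :
    evalPt (p * q) z = evalPt p z * evalPt q z := by
  simp [evalPt]

lemma IsDistinguishedPoly.mul {p q : MvPolynomial (Fin 2) ℂ} (hp : IsDistinguishedPoly p)
    (hq : IsDistinguishedPoly q) : IsDistinguishedPoly (p * q) := by
  have hU : zeroSet (p * q) = zeroSet p ∪ zeroSet q := by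
    ext z
    simp [zeroSet, evalPt_mul]
  refine ⟨hp.1.mono ?_, ?_⟩
  · rw [hU]
    exact Set.inter_subset_inter_left _ Set.subset_union_left
  · rw [hU, Set.union_inter_distrib_right, Set.union_inter_distrib_right, hp.2, hq.2]

/-- The extra factor `p` covers empty `s`: the constant `1` has no zero in `𝔾₂`. The exponent `n +
1` in `IsDistinguishedPoly.pow` has the same reason. -/
lemma IsDistinguishedPoly.mul_prod {ι : Type*} (s : Finset ι) (f : ι → MvPolynomial (Fin 2) ℂ)
    {p : MvPolynomial (Fin 2) ℂ} (hp : IsDistinguishedPoly p)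
    (hf : ∀ i ∈ s, IsDistinguishedPoly (f i)) : IsDistinguishedPoly (p * ∏ i ∈ s, f i) := by
  classical
  induction s using Finset.induction_on with
  | empty => simpa using hp
  | insert i s hi ih =>
    rw [Finset.prod_insert hi, mul_left_comm]
    exact (hf i (Finset.mem_insert_self i s)).mul
      (ih fun j hj => hf j (Finset.mem_insert_of_mem hj))

lemma IsDistinguishedPoly.pow {p : MvPolynomial (Fin 2) ℂ} (hp : IsDistinguishedPoly p) (n : ℕ) :
    IsDistinguishedPoly (p ^ (n + 1)) := by
  induction n with
  | zero => simpa using hp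
  | succ n ih => rw [pow_succ]; exact ih.mul hp

/-- Solving for `b` gives `b (1 - a c) = c̄ - a`, and `a ā = 1` turns the right side into `-a` times
the conjugate of `1 - a c`. -/
lemma norm_eq_one_of_conj_add_mul {a b c : ℂ} (ha : ‖a‖ = 1) (hc : ‖c‖ < 1)
    (h : star c + a * b * c = a + b) : ‖b‖ = 1 := by
  have haa : a * star a = 1 := by
    rw [Complex.star_def, Complex.mul_conj, Complex.normSq_eq_norm_sq, ha]; simp
  have h1 : b * (1 - a * c) = -(a * star (1 - a * c)) := by
    simp only [star_sub, star_mul, star_one]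
    linear_combination -h - star c * haa
  have h2 : 1 - a * c ≠ 0 := by
    intro h0
    have : ‖a * c‖ = 1 := by rw [← sub_eq_zero.1 h0, norm_one]
    rw [norm_mul, ha, one_mul] at this
    exact hc.ne this
  have h3 := congrArg norm h1
  rw [norm_mul, norm_neg, norm_mul, ha, one_mul, norm_star] at h3
  exact mul_right_cancel₀ (norm_ne_zero_iff.2 h2) (by rw [h3, one_mul])

/-- The polynomial `c̄ + c z₂ - z₁`. -/
def linPoly (c : ℂ) : MvPolynomial (Fin 2) ℂ :=
  MvPolynomial.C (star c) + MvPolynomial.C c * MvPolynomial.X 1 - MvPolynomial.X 0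

lemma evalPt_linPoly (c : ℂ) (z : ℂ × ℂ) : evalPt (linPoly c) z = star c + c * z.2 - z.1 := by
  simp [evalPt, linPoly]

lemma isDistinguishedPoly_linPoly {c : ℂ} (hc : ‖c‖ < 1) : IsDistinguishedPoly (linPoly c) := by
  refine isDistinguishedPoly_of_forall ⟨(star c, 0), ?_, (star c, 0), ?_, ?_⟩ ?_
  · simp [zeroSet, evalPt_linPoly]
  · simpa using hc
  · simp [symMap]
  · intro a b ha _ h
    rw [evalPt_linPoly] at h
    exact norm_eq_one_of_conj_add_mul ha hc (by linear_combination h)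

/-- The polynomial `z₁² - 4 z₂`, whose zero set is the royal variety. -/
def royalPoly : MvPolynomial (Fin 2) ℂ :=
  MvPolynomial.X 0 ^ 2 - 4 * MvPolynomial.X 1

lemma evalPt_royalPoly (z : ℂ × ℂ) : evalPt royalPoly z = z.1 ^ 2 - 4 * z.2 := by
  simp [evalPt, royalPoly]

lemma isDistinguishedPoly_royalPoly : IsDistinguishedPoly royalPoly := by
  refine isDistinguishedPoly_of_forall ⟨(0, 0), ?_, (0, 0), ?_, ?_⟩ ?_
  · simp [zeroSet, evalPt_royalPoly]
  · simp
  · simp [symMap]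
  · intro a b ha _ h
    rw [evalPt_royalPoly] at h
    have : (a - b) ^ 2 = 0 := by linear_combination h
    rw [← sub_eq_zero.1 (pow_eq_zero_iff (two_ne_zero) |>.1 this), ha]

/-- Every point of `bΓ` lies on the zero set of a distinguished polynomial. -/
lemma exists_isDistinguishedPoly_of_norm_snd_eq_one {z : ℂ × ℂ} (hz : z ∈ Gam)
    (h1 : ‖z.2‖ = 1) : ∃ p, IsDistinguishedPoly p ∧ evalPt p z = 0 := by
  obtain ⟨⟨a, b⟩, ⟨ha, hb⟩, rfl⟩ := hz
  simp only [symMap, norm_mul] at h1 ha hb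
  have ha1 : ‖a‖ = 1 := by nlinarith [norm_nonneg a, norm_nonneg b]
  have hb1 : ‖b‖ = 1 := by nlinarith [norm_nonneg a, norm_nonneg b]
  by_cases hab : a = b
  · refine ⟨_, isDistinguishedPoly_royalPoly, ?_⟩
    rw [evalPt_royalPoly, symMap, hab]
    ring
  -- The midpoint of two distinct unimodular numbers has modulus below 1, and `a b c = (a + b) / 2`
  -- because conjugation inverts `a` and `b`.
  · refine ⟨_, isDistinguishedPoly_linPoly (c := star ((a + b) / 2)) ?_, ?_⟩
    · rw [norm_star, norm_div, Complex.norm_ofNat, div_lt_one two_pos]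
      have hpar := parallelogram_law_with_norm ℝ a b
      have hpos : 0 < ‖a - b‖ := norm_pos_iff.2 (sub_ne_zero.2 hab)
      rw [ha1, hb1] at hpar
      nlinarith [norm_nonneg (a + b)]
    · have haa : a * star a = 1 := by
        rw [Complex.star_def, Complex.mul_conj, Complex.normSq_eq_norm_sq, ha1]; simp
      have hbb : b * star b = 1 := by
        rw [Complex.star_def, Complex.mul_conj, Complex.normSq_eq_norm_sq, hb1]; simp
      rw [evalPt_linPoly, star_star, star_div₀, star_add, symMap]
      simp only [star_ofNat]
      linear_combination (b / 2) * haa + (a / 2) * hbb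

/-- The witness solves `c̄ + c p = s` together with its conjugate equation. -/
lemma exists_isDistinguishedPoly_of_norm_sub_lt {s p : ℂ} (hp : ‖p‖ < 1)
    (h : ‖s - star s * p‖ < 1 - ‖p‖ ^ 2) :
    ∃ f, IsDistinguishedPoly f ∧ evalPt f (s, p) = 0 := by
  have hpos : 0 < 1 - ‖p‖ ^ 2 := by nlinarith [norm_nonneg p]
  have hne : ((1 - ‖p‖ ^ 2 : ℝ) : ℂ) ≠ 0 := by exact_mod_cast hpos.ne'
  have hpp : p * star p = ((‖p‖ ^ 2 : ℝ) : ℂ) := by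
    rw [Complex.star_def, Complex.mul_conj, Complex.normSq_eq_norm_sq]
  refine ⟨_, isDistinguishedPoly_linPoly
    (c := star (s - star s * p) / ((1 - ‖p‖ ^ 2 : ℝ) : ℂ)) ?_, ?_⟩
  · rw [norm_div, norm_star, Complex.norm_real, Real.norm_eq_abs, abs_of_pos hpos,
      div_lt_one hpos]
    exact h
  · have hs : star (((1 - ‖p‖ ^ 2 : ℝ)) : ℂ) = ((1 - ‖p‖ ^ 2 : ℝ) : ℂ) := Complex.conj_ofReal _
    rw [evalPt_linPoly, star_div₀, star_star, hs]
    field_simp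
    have h1 : ((1 - ‖p‖ ^ 2 : ℝ) : ℂ) = 1 - p * star p := by rw [hpp]; push_cast; ring
    rw [h1]
    simp only [star_sub, star_mul, star_star]
    ring

/-! ### The determinantal polynomials -/

section DetPoly

variable {E : Type*} [NormedAddCommGroup E] [InnerProductSpace ℂ E] [CompleteSpace E]
  [FiniteDimensional ℂ E]

lemma evalPt_detPoly (B : E →L[ℂ] E) (z : ℂ × ℂ) :
    evalPt (detPoly B) z = LinearMap.det ((ContinuousLinearMap.adjoint B).toLinearMap +
      z.2 • B.toLinearMap - z.1 • (1 : E →ₗ[ℂ] E)) := by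
  rw [← LinearMap.det_toMatrix (stdOrthonormalBasis ℂ E).toBasis, evalPt, detPoly, RingHom.map_det]
  congr 1
  ext i j
  simp [Matrix.one_apply, LinearMap.toMatrix_one]
  split_ifs <;> simp

lemma isDistinguishedPoly_detPoly [Nontrivial E] {B : E →L[ℂ] E}
    (hB : ∀ x : E, ‖x‖ = 1 → ‖⟪B x, x⟫_ℂ‖ < 1) : IsDistinguishedPoly (detPoly B) := by
  have unit : ∀ f : E →ₗ[ℂ] E, LinearMap.det f = 0 → ∃ x : E, ‖x‖ = 1 ∧ f x = 0 := by
    intro f hf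
    obtain ⟨y, hy, hy0⟩ := Submodule.exists_mem_ne_zero_of_ne_bot
      (LinearMap.det_eq_zero_iff_ker_ne_bot.1 hf)
    refine ⟨((‖y‖ : ℂ)⁻¹) • y, ?_, ?_⟩
    · rw [norm_smul, norm_inv, Complex.norm_real, norm_norm,
        inv_mul_cancel₀ (norm_ne_zero_iff.2 hy0)]
    · rw [map_smul, LinearMap.mem_ker.1 hy, smul_zero]
  have hinner : ∀ (x : E) (z : ℂ × ℂ), ‖x‖ = 1 →
      ((ContinuousLinearMap.adjoint B).toLinearMap +
        z.2 • B.toLinearMap - z.1 • (1 : E →ₗ[ℂ] E)) x = 0 →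
      star ⟪x, B x⟫_ℂ + z.2 * ⟪x, B x⟫_ℂ = z.1 := by
    intro x z hx h
    have h1 := congrArg (fun y => ⟪x, y⟫_ℂ) h
    simp only [LinearMap.sub_apply, LinearMap.add_apply, LinearMap.smul_apply,
      ContinuousLinearMap.coe_coe, Module.End.one_apply, inner_sub_right, inner_add_right,
      inner_smul_right, inner_zero_right, ContinuousLinearMap.adjoint_inner_right,
      inner_self_eq_norm_sq_to_K, hx] at h1
    rw [Complex.star_def, inner_conj_symm]
    simp at h1
    linear_combination h1
  have hB' : ∀ x : E, ‖x‖ = 1 → ‖⟪x, B x⟫_ℂ‖ < 1 := fun x hx => by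
    rw [norm_inner_symm]; exact hB x hx
  refine isDistinguishedPoly_of_forall ?_ ?_
  -- An eigenvalue `μ` of `B*` gives the zero `(μ, 0) = π(μ, 0)`.
  · obtain ⟨μ, hμ⟩ := Module.End.exists_eigenvalue (ContinuousLinearMap.adjoint B).toLinearMap
    have hdet : evalPt (detPoly B) (μ, 0) = 0 := by
      rw [evalPt_detPoly, zero_smul, add_zero, LinearMap.det_eq_zero_iff_ker_ne_bot]
      obtain ⟨v, hv, hv0⟩ := hμ.exists_hasEigenvector
      refine (Submodule.ne_bot_iff _).2 ⟨v, ?_, hv0⟩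
      rw [LinearMap.mem_ker]
      have := Module.End.mem_eigenspace_iff.1 hv
      simp only [LinearMap.sub_apply, this]
      simp
    refine ⟨(μ, 0), hdet, (μ, 0), ⟨?_, by simp⟩, by simp [symMap]⟩
    rw [evalPt_detPoly] at hdet
    obtain ⟨x, hx, h⟩ := unit _ hdet
    have := hinner x (μ, 0) hx h
    simp only [zero_mul, add_zero] at this
    rw [← this, norm_star]
    exact hB' x hx
  · intro a b ha _ h
    rw [evalPt_detPoly] at h
    obtain ⟨x, hx, h⟩ := unit _ h
    exact norm_eq_one_of_conj_add_mul ha (hB' x hx) (hinner x (a + b, a * b) hx h)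

end DetPoly

/-! ### Polynomials in a commuting pair -/

section PolyApply

variable {H : Type*} [NormedAddCommGroup H] [InnerProductSpace ℂ H]

/-- `MvPolynomial.aeval` needs a commutative target, so evaluation takes place in the subalgebra
generated by `S` and `P`. -/
lemma exists_algHom_polyApply {S P : H →L[ℂ] H} (h : Commute S P) :
    ∃ φ : MvPolynomial (Fin 2) ℂ →ₐ[ℂ] (H →L[ℂ] H),
      (∀ p, φ p = polyApply p S P) ∧ φ (MvPolynomial.X 0) = S ∧ φ (MvPolynomial.X 1) = P := by
  have hc : ∀ a ∈ ({S, P} : Set (H →L[ℂ] H)), ∀ b ∈ ({S, P} : Set (H →L[ℂ] H)),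
      a * b = b * a := by
    rintro a (rfl | rfl) b (rfl | rfl)
    exacts [rfl, h.eq, h.eq.symm, rfl]
  let _ : CommRing (Algebra.adjoin ℂ ({S, P} : Set (H →L[ℂ] H))) :=
    { (inferInstance : Ring (Algebra.adjoin ℂ ({S, P} : Set (H →L[ℂ] H)))) with
      mul_comm := (Algebra.isMulCommutative_adjoin ℂ hc).is_comm.comm }
  let S' : Algebra.adjoin ℂ ({S, P} : Set (H →L[ℂ] H)) := ⟨S, Algebra.subset_adjoin (by simp)⟩
  let P' : Algebra.adjoin ℂ ({S, P} : Set (H →L[ℂ] H)) := ⟨P, Algebra.subset_adjoin (by simp)⟩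
  refine ⟨(Subalgebra.val _).comp (MvPolynomial.aeval ![S', P']), fun p => ?_, ?_, ?_⟩
  · rw [polyApply, AlgHom.comp_apply, MvPolynomial.aeval_def, MvPolynomial.eval₂_eq', map_sum]
    refine Finset.sum_congr rfl fun m _ => ?_
    rw [← Algebra.smul_def, map_smul, Fin.prod_univ_two]
    rfl
  · simp [S']
  · simp [P']

lemma algHom_apply_of_eigenvector {S P : H →L[ℂ] H}
    {φ : MvPolynomial (Fin 2) ℂ →ₐ[ℂ] (H →L[ℂ] H)} (hS : φ (MvPolynomial.X 0) = S)
    (hP : φ (MvPolynomial.X 1) = P) {x : H} {z : ℂ × ℂ} (h1 : S x = z.1 • x) (h2 : P x = z.2 • x)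
    (p : MvPolynomial (Fin 2) ℂ) : φ p x = evalPt p z • x := by
  induction p using MvPolynomial.induction_on with
  | C a =>
    rw [← MvPolynomial.algebraMap_eq, AlgHom.commutes, Algebra.algebraMap_eq_smul_one]
    simp [evalPt]
  | add p q hp hq => simp [evalPt, add_smul] at *; rw [hp, hq]
  | mul_X p i hp =>
    rw [evalPt_mul, map_mul, mul_apply_eq_comp]
    fin_cases i
    · simp only [Fin.zero_eta, hS, h1, map_smul, hp, smul_smul]
      simp [evalPt, mul_comm]
    · simp only [Fin.mk_one, hP, h2, map_smul, hp, smul_smul]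
      simp [evalPt, mul_comm]

/-- If `Σ_j d_j ∘ φ(M_ij) = 0` for all `i`, then `det M` annihilates each functional `d_k`. -/
lemma apply_det_eq_zero {R n : Type*} [CommRing R] [Fintype n] [DecidableEq n]
    (φ : R →+* (H →L[ℂ] H)) (M : Matrix n n R) (d : n → (H →ₗ[ℂ] ℂ))
    (h : ∀ i x, ∑ j, d j (φ (M i j) x) = 0) (k : n) (x : H) : d k (φ M.det x) = 0 := by
  -- Combining the relations with row `k` of the adjugate leaves only the determinant, as `adj(M) M
  -- = det M`.
  have h1 : ∑ i, ∑ j, d j (φ (M i j) (φ (M.adjugate k i) x)) = 0 :=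
    Finset.sum_eq_zero fun i _ => h i _
  rw [Finset.sum_comm] at h1
  have h2 : ∀ j, ∑ i, d j (φ (M i j) (φ (M.adjugate k i) x)) =
      d j (φ ((M.adjugate * M) k j) x) := by
    intro j
    rw [Matrix.mul_apply, map_sum, sum_apply, map_sum]
    refine Finset.sum_congr rfl fun i _ => ?_
    rw [← mul_apply_eq_comp, ← map_mul, mul_comm]
  simp only [h2, Matrix.adjugate_mul] at h1
  rw [Finset.sum_eq_single k (fun j _ hj => by simp [Matrix.one_apply_ne hj.symm])
    (by simp)] at h1
  simpa using h1

/-- A subspace `W ≠ 0` invariant under `T` contains an eigenvector of `T`. -/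
lemma exists_inf_eigenspace_ne_bot {V : Type*} [AddCommGroup V] [Module ℂ V]
    [FiniteDimensional ℂ V] (T : Module.End ℂ V) {W : Submodule ℂ V} (hW : W ≠ ⊥)
    (hT : ∀ x ∈ W, T x ∈ W) : ∃ μ, W ⊓ T.eigenspace μ ≠ ⊥ := by
  have := Submodule.nontrivial_iff_ne_bot.2 hW
  obtain ⟨μ, hμ⟩ := Module.End.exists_eigenvalue (T.restrict hT)
  obtain ⟨v, hv, hv0⟩ := hμ.exists_hasEigenvector
  refine ⟨μ, (Submodule.ne_bot_iff _).2 ⟨v, ⟨v.2, ?_⟩, by simpa using hv0⟩⟩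
  have := congrArg Subtype.val (Module.End.mem_eigenspace_iff.1 hv)
  exact Module.End.mem_eigenspace_iff.2 this

lemma exists_pow_eq_zero_of_eigenvalues {V : Type*} [AddCommGroup V] [Module ℂ V]
    [FiniteDimensional ℂ V] (T : Module.End ℂ V)
    (h : ∀ μ, μ ≠ 0 → T.eigenspace μ = ⊥) : ∃ n : ℕ, T ^ n = 0 := by
  have h1 : T.maxGenEigenspace 0 = ⊤ := by
    rw [eq_top_iff, ← Module.End.iSup_maxGenEigenspace_eq_top T]
    refine iSup_le fun μ => ?_
    by_cases hμ : μ = 0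
    · rw [hμ]
    · have : T.maxGenEigenspace μ = ⊥ := by
        by_contra hne
        obtain ⟨x, ⟨hx, hx'⟩⟩ := Submodule.ne_bot_iff _ |>.1 hne
        exact Module.End.hasEigenvalue_iff.1 (Module.End.hasEigenvalue_of_hasGenEigenvalue
          (k := Module.finrank ℂ V) (by
            rw [Module.End.HasGenEigenvalue, Module.End.HasUnifEigenvalue,
              ← Module.End.maxGenEigenspace_eq_genEigenspace_finrank]
            exact hne)) (h μ hμ)
      rw [this]
      exact bot_le
  refine ⟨Module.finrank ℂ V, LinearMap.ext fun x => ?_⟩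
  have hx : x ∈ T.maxGenEigenspace 0 := h1 ▸ Submodule.mem_top
  rw [Module.End.maxGenEigenspace_eq_genEigenspace_finrank, Module.End.mem_genEigenspace_nat] at hx
  simpa using hx

/-- A polynomial vanishing at all joint eigenvalues of a commuting pair is nilpotent on it. -/
lemma exists_pow_eq_zero_of_evalPt_eq_zero [FiniteDimensional ℂ H] {S P : H →L[ℂ] H}
    {φ : MvPolynomial (Fin 2) ℂ →ₐ[ℂ] (H →L[ℂ] H)} (hS : φ (MvPolynomial.X 0) = S)
    (hP : φ (MvPolynomial.X 1) = P) (p : MvPolynomial (Fin 2) ℂ)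
    (h : ∀ (z : ℂ × ℂ) (x : H), x ≠ 0 → S x = z.1 • x → P x = z.2 • x → evalPt p z = 0) :
    ∃ n : ℕ, φ (p ^ n) = 0 := by
  have hcomm : ∀ q r x, φ q (φ r x) = φ r (φ q x) := fun q r x => by
    rw [← mul_apply_eq_comp, ← map_mul, mul_comm, map_mul,
      mul_apply_eq_comp]
  have inv : ∀ (q r : MvPolynomial (Fin 2) ℂ) (μ : ℂ) (x : H),
      x ∈ Module.End.eigenspace (φ q).toLinearMap μ →
        φ r x ∈ Module.End.eigenspace (φ q).toLinearMap μ := by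
    intro q r μ x hx
    rw [Module.End.mem_eigenspace_iff, ContinuousLinearMap.coe_coe] at *
    rw [hcomm, hx, map_smul]
  -- An eigenspace of `φ p` for `μ ≠ 0` would be invariant under `S` and `P`, so contain a joint
  -- eigenvector, on which `φ p` acts as `p(z) = 0`.
  obtain ⟨n, hn⟩ := exists_pow_eq_zero_of_eigenvalues (φ p).toLinearMap (by
    intro μ hμ
    by_contra hW
    obtain ⟨s, hs⟩ := exists_inf_eigenspace_ne_bot (φ (MvPolynomial.X 0)).toLinearMap hW
      (fun x hx => inv _ _ _ _ hx)
    obtain ⟨t, ht⟩ := exists_inf_eigenspace_ne_bot (φ (MvPolynomial.X 1)).toLinearMap hs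
      (fun x hx => ⟨inv _ _ _ _ hx.1, inv _ _ _ _ hx.2⟩)
    obtain ⟨x, ⟨⟨hx1, hx2⟩, hx3⟩, hx0⟩ := (Submodule.ne_bot_iff _).1 ht
    have hx1 := Module.End.mem_eigenspace_iff.1 hx1
    have hx2 := Module.End.mem_eigenspace_iff.1 hx2
    have hx3 := Module.End.mem_eigenspace_iff.1 hx3
    simp only [hS, hP, ContinuousLinearMap.coe_coe] at hx1 hx2 hx3
    have := algHom_apply_of_eigenvector hS hP (z := (s, t)) hx2 hx3 p
    rw [h (s, t) x hx0 hx2 hx3, zero_smul, hx1] at this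
    exact (smul_ne_zero hμ hx0) this)
  refine ⟨n, ContinuousLinearMap.ext fun x => ?_⟩
  have := LinearMap.congr_fun hn x
  rw [map_pow]
  rw [← ContinuousLinearMap.toLinearMap_pow] at this
  exact this

end PolyApply

/-! ### `Γ`-contractions and their fundamental operators -/

section Operators

variable {H : Type*} [NormedAddCommGroup H] [InnerProductSpace ℂ H]

lemma IsGammaContraction.norm_snd_le {S P : H →L[ℂ] H} (h : IsGammaContraction S P) :
    ‖P‖ ≤ 1 := by
  obtain ⟨φ, hφ, -, hP⟩ := exists_algHom_polyApply h.commute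
  have h1 := h.norm_le (MvPolynomial.X 1) 1 (fun z _ => by simp [evalPt])
  rw [← hφ, ← hφ, hP, map_one, Ring.inverse_one, mul_one] at h1
  refine h1.trans (Real.iSup_le (fun z => ?_) zero_le_one)
  simpa [evalPt] using norm_snd_le_of_mem_Gam z.2

lemma IsGammaContraction.mem_Gam {S P : H →L[ℂ] H} (h : IsGammaContraction S P) {z : ℂ × ℂ}
    {x : H} (hx : x ≠ 0) (h1 : S x = z.1 • x) (h2 : P x = z.2 • x) : z ∈ Gam :=
  h.spectrum_subset fun hz => hx (hz.1 x (sub_eq_zero.2 h1) (sub_eq_zero.2 h2))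

lemma norm_inner_le_numericalRadius {E : Type*} [NormedAddCommGroup E] [InnerProductSpace ℂ E]
    (T : E →L[ℂ] E) {x : E} (hx : ‖x‖ = 1) : ‖⟪T x, x⟫_ℂ‖ ≤ numericalRadius T := by
  refine le_csSup ⟨‖T‖, ?_⟩ ⟨x, hx, rfl⟩
  rintro _ ⟨y, hy, rfl⟩
  have h1 := norm_inner_le_norm (𝕜 := ℂ) (T y) y
  have h2 := T.le_opNorm y
  rw [hy, mul_one] at h1 h2
  exact h1.trans h2

lemma norm_inner_le_numericalRadius_mul_sq {E : Type*} [NormedAddCommGroup E]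
    [InnerProductSpace ℂ E] (T : E →L[ℂ] E) (x : E) :
    ‖⟪T x, x⟫_ℂ‖ ≤ numericalRadius T * ‖x‖ ^ 2 := by
  rcases eq_or_ne x 0 with rfl | hx
  · simp
  have hx' : ‖x‖ ≠ 0 := norm_ne_zero_iff.2 hx
  have h1 := norm_inner_le_numericalRadius T (x := ((‖x‖ : ℂ)⁻¹) • x) (by
    rw [norm_smul, norm_inv, Complex.norm_real, norm_norm, inv_mul_cancel₀ hx'])
  rw [map_smul, inner_smul_left, inner_smul_right, norm_mul, norm_mul, RCLike.norm_conj, norm_inv,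
    Complex.norm_real, norm_norm] at h1
  calc ‖⟪T x, x⟫_ℂ‖ = ‖x‖⁻¹ * (‖x‖⁻¹ * ‖⟪T x, x⟫_ℂ‖) * ‖x‖ ^ 2 := by field_simp
    _ ≤ _ := by gcongr

variable [CompleteSpace H]

lemma defectOp_inner (P : H →L[ℂ] H) (x y : H) : ⟪defectOp P x, y⟫_ℂ = ⟪x, defectOp P y⟫_ℂ := by
  have h : IsSelfAdjoint (defectOp P) := IsSelfAdjoint.of_nonneg (CFC.sqrt_nonneg _)
  rw [← ContinuousLinearMap.adjoint_inner_right, h.adjoint_eq]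

lemma defectOp_mul_self {P : H →L[ℂ] H} (hP : ‖P‖ ≤ 1) (x : H) :
    defectOp P (defectOp P x) = x - ContinuousLinearMap.adjoint P (P x) := by
  have h0 : 0 ≤ 1 - ContinuousLinearMap.adjoint P * P := by
    rw [ContinuousLinearMap.nonneg_iff_isPositive, ContinuousLinearMap.isPositive_iff']
    refine ⟨(IsSelfAdjoint.one _).sub (IsSelfAdjoint.star_mul_self P), fun y => ?_⟩
    have h1 : ‖P y‖ ≤ ‖y‖ := (P.le_opNorm y).trans (mul_le_of_le_one_left (norm_nonneg y) hP)
    have h2 : ⟪(1 - ContinuousLinearMap.adjoint P * P) y, y⟫_ℂ =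
        ((‖y‖ ^ 2 - ‖P y‖ ^ 2 : ℝ) : ℂ) := by
      simp [ContinuousLinearMap.adjoint_inner_left, inner_self_eq_norm_sq_to_K]
    rw [h2]
    have h3 : 0 ≤ ‖y‖ ^ 2 - ‖P y‖ ^ 2 := by nlinarith [norm_nonneg (P y)]
    exact_mod_cast h3
  have h := DFunLike.congr_fun (CFC.sqrt_mul_sqrt_self _ h0) x
  exact h

lemma norm_defectOp_sq {P : H →L[ℂ] H} (hP : ‖P‖ ≤ 1) (x : H) :
    ‖defectOp P x‖ ^ 2 = ‖x‖ ^ 2 - ‖P x‖ ^ 2 := by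
  have h : ⟪defectOp P x, defectOp P x⟫_ℂ = ((‖x‖ ^ 2 - ‖P x‖ ^ 2 : ℝ) : ℂ) := by
    rw [defectOp_inner, defectOp_mul_self hP]
    simp [ContinuousLinearMap.adjoint_inner_right, inner_self_eq_norm_sq_to_K]
  rw [inner_self_eq_norm_sq_to_K] at h
  exact Complex.ofReal_injective (by simpa using h)

/-- `D_P` is injective on `𝒟_P`. -/
lemma eq_zero_of_defectOp_eq_zero {P : H →L[ℂ] H} (g : defectSpace P)
    (h : defectOp P (g : H) = 0) : g = 0 := by
  have h1 : defectSpace P ≤ (ℂ ∙ (g : H))ᗮ := by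
    refine Submodule.topologicalClosure_minimal _ ?_ (Submodule.isClosed_orthogonal _)
    rintro _ ⟨z, rfl⟩
    rw [Submodule.mem_orthogonal_singleton_iff_inner_left, ContinuousLinearMap.coe_coe,
      defectOp_inner, h, inner_zero_right]
  have h2 := Submodule.mem_orthogonal_singleton_iff_inner_left.1 (h1 g.2)
  exact Subtype.ext (inner_self_eq_zero.1 h2)

variable {S P : H →L[ℂ] H} {A : defectSpace P →L[ℂ] defectSpace P}

lemma IsFundamentalOperator.adjoint_apply [CompleteSpace (defectSpace P)]
    (hA : IsFundamentalOperator S P A) (x : H) :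
    defectOp P (ContinuousLinearMap.adjoint A (toDefect P x) : H) =
      ContinuousLinearMap.adjoint S x - ContinuousLinearMap.adjoint P (S x) := by
  refine ext_inner_right ℂ fun y => ?_
  have h1 : ⟪(ContinuousLinearMap.adjoint A (toDefect P x) : H), defectOp P y⟫_ℂ =
      ⟪ContinuousLinearMap.adjoint A (toDefect P x), toDefect P y⟫_ℂ := rfl
  have h2 : ⟪toDefect P x, A (toDefect P y)⟫_ℂ =
      ⟪defectOp P x, (A (toDefect P y) : H)⟫_ℂ := rfl
  rw [defectOp_inner, h1, ContinuousLinearMap.adjoint_inner_left, h2, defectOp_inner, ← hA y,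
    inner_sub_left, inner_sub_right, ContinuousLinearMap.adjoint_inner_left,
    ContinuousLinearMap.adjoint_inner_left, ContinuousLinearMap.adjoint_inner_right]

/-- The identity `D_P S = A D_P + A* D_P P`. -/
lemma IsFundamentalOperator.toDefect_apply [CompleteSpace (defectSpace P)]
    (hA : IsFundamentalOperator S P A)
    (hc : Commute S P) (hP : ‖P‖ ≤ 1) (x : H) :
    toDefect P (S x) = A (toDefect P x) + ContinuousLinearMap.adjoint A (toDefect P (P x)) := by
  rw [← sub_eq_zero]
  -- Injectivity of `D_P` on `𝒟_P` allows comparison after applying `D_P`; both sides then become `S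
  -- - P*PS`.
  refine eq_zero_of_defectOp_eq_zero _ ?_
  have hSP : S (P x) = P (S x) := DFunLike.congr_fun hc.eq x
  have h1 : (toDefect P (S x) : H) = defectOp P (S x) := rfl
  rw [Submodule.coe_sub, Submodule.coe_add, map_sub, map_add, ← hA x, hA.adjoint_apply, h1,
    defectOp_mul_self hP, hSP]
  abel

/-- A joint eigenvalue `(s, p)` with `|p| < 1` satisfies `|s - s̄ p| < 1 - |p|²`. -/
lemma IsFundamentalOperator.norm_sub_lt (hA : IsFundamentalOperator S P A) (hP : ‖P‖ ≤ 1)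
    (hω : numericalRadius A < 1) {s p : ℂ} {x : H} (hx : x ≠ 0) (h1 : S x = s • x)
    (h2 : P x = p • x) (hp : ‖p‖ < 1) : ‖s - star s * p‖ < 1 - ‖p‖ ^ 2 := by
  have hx2 : 0 < ‖x‖ ^ 2 := by have := norm_pos_iff.2 hx; positivity
  have hpos : 0 < 1 - ‖p‖ ^ 2 := by nlinarith [norm_nonneg p]
  have hD : ‖toDefect P x‖ ^ 2 = (1 - ‖p‖ ^ 2) * ‖x‖ ^ 2 := by
    have : ‖toDefect P x‖ = ‖defectOp P x‖ := rfl
    rw [this, norm_defectOp_sq hP, h2, norm_smul]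
    ring
  have hin : ⟪toDefect P x, A (toDefect P x)⟫_ℂ = (s - star s * p) * ((‖x‖ ^ 2 : ℝ) : ℂ) := by
    have : ⟪toDefect P x, A (toDefect P x)⟫_ℂ = ⟪defectOp P x, (A (toDefect P x) : H)⟫_ℂ := rfl
    rw [this, defectOp_inner, ← hA x, inner_sub_right, ContinuousLinearMap.adjoint_inner_right,
      h1, h2, inner_smul_left, inner_smul_right, inner_smul_right, inner_self_eq_norm_sq_to_K]
    simp
    ring
  have h3 := norm_inner_le_numericalRadius_mul_sq A (toDefect P x)
  rw [norm_inner_symm, hin, hD, norm_mul, Complex.norm_real, Real.norm_eq_abs, abs_of_pos hx2,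
    ← mul_assoc] at h3
  have h4 := le_of_mul_le_mul_right h3 hx2
  exact h4.trans_lt (mul_lt_of_lt_one_left hpos hω)

/-- If `P` is pure, an operator `Q` commuting with `P` with `D_P Q = 0` vanishes. -/
lemma IsPure.eq_zero_of_defectOp_comp [FiniteDimensional ℂ H] (hp : IsPure P) (hP : ‖P‖ ≤ 1)
    {Q : H →L[ℂ] H} (hc : Commute Q P) (h : ∀ x, defectOp P (Q x) = 0) : Q = 0 := by
  ext x
  have h1 : ∀ y, ‖P (Q y)‖ = ‖Q y‖ := by
    intro y
    have := norm_defectOp_sq hP (Q y)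
    rw [h y, norm_zero] at this
    nlinarith [norm_nonneg (P (Q y)), norm_nonneg (Q y)]
  have h2 : ∀ n : ℕ, ‖(P ^ n) (Q x)‖ = ‖Q x‖ := by
    intro n
    induction n with
    | zero => simp
    | succ n ih =>
      have hn : (P ^ n) (Q x) = Q ((P ^ n) x) :=
        (DFunLike.congr_fun (hc.pow_right n).eq x).symm
      rw [pow_succ', mul_apply_eq_comp, hn, h1, ← hn, ih]
  -- Purity concerns `P*ⁿ` and yields only weak convergence of `Pⁿ`; finite dimension makes it
  -- strong.
  have h3 : Filter.Tendsto (fun n : ℕ => (P ^ n) (Q x)) Filter.atTop (nhds 0) := by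
    let b := stdOrthonormalBasis ℂ H
    have h4 : ∀ i, Filter.Tendsto (fun n : ℕ => ⟪b i, (P ^ n) (Q x)⟫_ℂ) Filter.atTop
        (nhds 0) := by
      intro i
      have h5 := (hp (b i)).inner (tendsto_const_nhds (x := Q x) (f := Filter.atTop)) (𝕜 := ℂ)
      rw [inner_zero_left] at h5
      refine h5.congr fun n => ?_
      rw [← ContinuousLinearMap.star_eq_adjoint, ← star_pow, ContinuousLinearMap.star_eq_adjoint,
        ContinuousLinearMap.adjoint_inner_left]
    have h6 := tendsto_finsetSum Finset.univ fun i _ =>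
      (h4 i).smul (tendsto_const_nhds (x := b i) (f := Filter.atTop))
    simp only [zero_smul, Finset.sum_const_zero] at h6
    exact h6.congr fun n => b.sum_repr' _
  have h7 := h3.norm
  simp only [h2, norm_zero] at h7
  simpa using tendsto_nhds_unique tendsto_const_nhds h7

lemma IsFundamentalOperator.polyApply_detPoly_adjoint [FiniteDimensional ℂ H]
    (hA : IsFundamentalOperator S P A) (hc : Commute S P) (hP : ‖P‖ ≤ 1) (hp : IsPure P) :
    polyApply (detPoly (ContinuousLinearMap.adjoint A)) S P = 0 := by
  obtain ⟨φ, hφ, hS, hP'⟩ := exists_algHom_polyApply hc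
  have hQ : ∀ p, Commute (φ p) P := fun p => by
    rw [← hP']
    exact (Commute.all _ _).map φ
  rw [← hφ]
  refine hp.eq_zero_of_defectOp_comp hP (hQ _) fun x => ?_
  let b := stdOrthonormalBasis ℂ (defectSpace P)
  let D : H →ₗ[ℂ] defectSpace P := (defectOp P).toLinearMap.codRestrict _
    fun x => Submodule.le_topologicalClosure _ ⟨x, rfl⟩
  have hD : ∀ x, D x = toDefect P x := fun _ => rfl
  have key : D (φ (detPoly (ContinuousLinearMap.adjoint A)) x) = 0 := by
    refine b.toBasis.ext_elem fun k => ?_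
    rw [map_zero, Finsupp.zero_apply]
    -- The functionals are the coordinates of `D_P`; row `i` of the hypothesis is coordinate `i` of
    -- `A D_P + A* D_P P - D_P S = 0`.
    refine apply_det_eq_zero φ.toRingHom _ (fun j => b.toBasis.coord j ∘ₗ D) ?_ k x
    intro i x
    have hC : ∀ c : ℂ, φ (MvPolynomial.C c) = c • 1 := fun c => by
      rw [← MvPolynomial.algebraMap_eq, AlgHom.commutes, Algebra.algebraMap_eq_smul_one]
    have h1 : ∀ (T : defectSpace P →L[ℂ] defectSpace P) (y : defectSpace P),
        ∑ j, LinearMap.toMatrix b.toBasis b.toBasis T.toLinearMap i j * b.toBasis.repr y j =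
          b.toBasis.repr (T y) i := fun T y =>
      congrFun (LinearMap.toMatrix_mulVec_repr b.toBasis b.toBasis T.toLinearMap y) i
    have h2 := congrArg (fun y => b.toBasis.repr y i) (hA.toDefect_apply hc hP x)
    simp only [map_add, Finsupp.add_apply] at h2
    rw [← h1 A, ← h1 (ContinuousLinearMap.adjoint A)] at h2
    have h3 : ∑ j, b.toBasis.repr (D (φ (((MvPolynomial.X 0 : MvPolynomial (Fin 2) ℂ) •
        (1 : Matrix _ _ (MvPolynomial (Fin 2) ℂ))) i j) x)) j =
        b.toBasis.repr (toDefect P (S x)) i := by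
      rw [Finset.sum_eq_single i]
      · simp [hS, hD]
      · intro j _ hj
        simp [Matrix.one_apply_ne hj.symm]
      · simp
    simp only [AlgHom.toRingHom_eq_coe, RingHom.coe_coe, LinearMap.comp_apply,
      Module.Basis.coord_apply, ContinuousLinearMap.adjoint_adjoint, Matrix.sub_apply,
      Matrix.add_apply, map_sub, map_add, sub_apply,
      add_apply,
      Finset.sum_sub_distrib, Finset.sum_add_distrib]
    rw [h3, h2, sub_eq_zero]
    congr 1
    · refine Finset.sum_congr rfl fun j _ => ?_
      simp [hC, ← hD, b]
    · refine Finset.sum_congr rfl fun j _ => ?_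
      simp [hC, ← hD, hP', b]
  exact congrArg Subtype.val key

lemma IsGammaContraction.exists_isDistinguishedPoly [FiniteDimensional ℂ H]
    (h : IsGammaContraction S P) (hA : IsFundamentalOperator S P A)
    (hω : numericalRadius A < 1) :
    ∃ p : MvPolynomial (Fin 2) ℂ, IsDistinguishedPoly p ∧ polyApply p S P = 0 := by
  classical
  obtain ⟨φ, hφ, hS, hP⟩ := exists_algHom_polyApply h.commute
  have key : ∀ z : ℂ × ℂ, ∃ f, IsDistinguishedPoly f ∧
      ∀ x : H, x ≠ 0 → S x = z.1 • x → P x = z.2 • x → evalPt f z = 0 := by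
    intro z
    by_cases hz : ∃ x : H, x ≠ 0 ∧ S x = z.1 • x ∧ P x = z.2 • x
    · obtain ⟨x, hx, h1, h2⟩ := hz
      have hG := h.mem_Gam hx h1 h2
      obtain ⟨f, hf, hf0⟩ : ∃ f, IsDistinguishedPoly f ∧ evalPt f z = 0 := by
        rcases (norm_snd_le_of_mem_Gam hG).lt_or_eq with hlt | heq
        · exact exists_isDistinguishedPoly_of_norm_sub_lt hlt
            (hA.norm_sub_lt h.norm_snd_le hω hx h1 h2 hlt)
        · exact exists_isDistinguishedPoly_of_norm_snd_eq_one hG heq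
      exact ⟨f, hf, fun _ _ _ _ => hf0⟩
    · exact ⟨royalPoly, isDistinguishedPoly_royalPoly,
        fun x hx h1 h2 => absurd ⟨x, hx, h1, h2⟩ hz⟩
  choose f hf hf0 using key
  -- The product of the two sets of eigenvalues is finite and contains every joint eigenvalue; its
  -- other points contribute harmless distinguished factors.
  have hfin := (Module.End.finite_hasEigenvalue S.toLinearMap).prod
    (Module.End.finite_hasEigenvalue P.toLinearMap)
  let p := royalPoly * ∏ z ∈ hfin.toFinset, f z
  have hp : IsDistinguishedPoly p :=
    isDistinguishedPoly_royalPoly.mul_prod _ _ fun z _ => hf z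
  obtain ⟨n, hn⟩ := exists_pow_eq_zero_of_evalPt_eq_zero hS hP p (by
    intro z x hx h1 h2
    have hz : z ∈ hfin.toFinset := by
      rw [Set.Finite.mem_toFinset]
      exact ⟨Module.End.hasEigenvalue_of_hasEigenvector
          ⟨Module.End.mem_eigenspace_iff.2 h1, hx⟩,
        Module.End.hasEigenvalue_of_hasEigenvector ⟨Module.End.mem_eigenspace_iff.2 h2, hx⟩⟩
    rw [evalPt_mul, ← Finset.mul_prod_erase _ _ hz, evalPt_mul, hf0 z x hx h1 h2]
    ring)
  exact ⟨p ^ (n + 1), hp.pow n, by rw [← hφ, pow_succ, map_mul, hn, zero_mul]⟩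

end Operators

end SymBidisc

end

theorem mainTheorem4 {H : Type*} [NormedAddCommGroup H] [InnerProductSpace ℂ H]
    [CompleteSpace H] [FiniteDimensional ℂ H] (S P : H →L[ℂ] H)
    (hSP : SymBidisc.IsGammaContraction S P)
    (A : SymBidisc.defectSpace P →L[ℂ] SymBidisc.defectSpace P)
    (hA : SymBidisc.IsFundamentalOperator S P A)
    (hω : SymBidisc.numericalRadius A < 1) :
    SymBidisc.IsDistinguishedContraction S P ∧
    (SymBidisc.defectSpace P ≠ ⊥ →
      SymBidisc.IsDistinguishedPoly (SymBidisc.detPoly A) ∧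
      SymBidisc.IsDistinguishedPoly (SymBidisc.detPoly (ContinuousLinearMap.adjoint A))) ∧
    (SymBidisc.IsPure P →
      SymBidisc.polyApply (SymBidisc.detPoly (ContinuousLinearMap.adjoint A)) S P = 0) := by
  have hP := hSP.norm_snd_le
  refine ⟨⟨hSP, hSP.exists_isDistinguishedPoly hA hω⟩, fun hne => ?_,
    hA.polyApply_detPoly_adjoint hSP.commute hP⟩
  have := Submodule.nontrivial_iff_ne_bot.2 hne
  refine ⟨SymBidisc.isDistinguishedPoly_detPoly fun x hx =>
      (SymBidisc.norm_inner_le_numericalRadius A hx).trans_lt hω,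
    SymBidisc.isDistinguishedPoly_detPoly fun x hx => ?_⟩
  rw [ContinuousLinearMap.adjoint_inner_left, norm_inner_symm]
  exact (SymBidisc.norm_inner_le_numericalRadius A hx).trans_lt hω
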